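/- Let $\mathcal{S}_n$ be the set of permutations $\pi=a_1a_2\cdots a_n$ of $[n]=\{1,\dots,n\}$, let $\mathrm{inv}(\pi)=\#\{(i,j): i<j,\ a_i>a_j\}$ be the number of inversions of $\pi$, and for an integer $k$ let $\mathcal{S}_n^k=\{\pi\in\mathcal{S}_n:\mathrm{inv}(\pi)=k\}$ (so $\mathcal{S}_n^k=\emptyset$ if $k<0$). Let $\mathcal{C}_n$ be the set of those permutations in $\mathcal{S}_n^{n-1}$ whose every prefix $a_1\cdots a_k$ with $1\le k\le n$ has fewer than $k$ inversions; in particular $\mathcal{C}_0=\emptyset$. Let $C_n=\frac{1}{n+1}\binom{2n}{n}$ be the Catalan numbers, and put $$C(x)=\sum_{n\ge0}C_nx^n,\qquad S_i(x)=\sum_{n\ge 0}|\mathcal{S}_n^{n-i}|\,x^n\quad(i\ge0)$$ as formal power series. **Theorem.** For every $n\ge1$ we have $|\mathcal{C}_n|=C_{n-1}$. For all integers $i\ge 0$ and $n\ge0$ there is a bijection $$\mathcal{S}_n^{n-i-1}\;\simeq\;\bigcup_{k=0}^n \mathcal{S}_k^{k-i}\times\mathcal{C}_{n-k}$$ (a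 disjoint union). Consequently, for every $i\ge0$, $$S_{i+1}(x)=xC(x)\,S_i(x),\qquad\text{equivalently}\qquad S_i(x)=(xC(x))^i\,S_0(x).$$ -/

import Mathlib

namespace FewInversions

/-- Permutations `π = a₁a₂…aₙ` of `[n]` are modelled by `Equiv.Perm (Fin n)` with letters
`a_{j+1} = π j` (everything shifted by one). The entry of the inversion table of `π` at
position `j`: the number of letters to the left of and larger than the letter at `j`. -/
def invTable {n : ℕ} (π : Equiv.Perm (Fin n)) (j : Fin n) : ℕ :=
  (Finset.univ.filter fun i : Fin n => i < j ∧ π j < π i).card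

/-- The number of inversions of `π`. -/
def inv {n : ℕ} (π : Equiv.Perm (Fin n)) : ℕ :=
  ∑ j, invTable π j

/-- The number of inversions of the prefix of `π` that consists of its first `k` letters. -/
def prefixInv {n : ℕ} (π : Equiv.Perm (Fin n)) (k : ℕ) : ℕ :=
  ∑ j ∈ Finset.univ.filter (fun j : Fin n => (j : ℕ) < k), invTable π j

/-- `permsInv n k` is the set of permutations of `[n]` with exactly `k` inversions. The number `k`
is an integer, so the set is empty for negative `k`. -/
def permsInv (n : ℕ) (k : ℤ) : Finset (Equiv.Perm (Fin n)) :=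
  Finset.univ.filter fun π => (inv π : ℤ) = k

/-- `catPerms n` is the set of those permutations of `[n]` with exactly `n - 1` inversions (an
integer, so that `catPerms 0` is empty) whose every prefix of length `k ≥ 1` has fewer than `k`
inversions. -/
def catPerms (n : ℕ) : Finset (Equiv.Perm (Fin n)) :=
  (permsInv n ((n : ℤ) - 1)).filter fun π => ∀ k ≤ n, 1 ≤ k → prefixInv π k < k

/-- The generating function, by length `n`, of the permutations of `[n]` with exactly `n - i`
inversions. -/
def S (i : ℕ) : PowerSeries ℕ :=
  PowerSeries.mk fun n => (permsInv n ((n : ℤ) - (i : ℤ))).card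

end FewInversions

namespace FewInversions

open Finset

/-! A permutation is encoded by its inversion table, whose entry at the m-th letter ranges freely
over 0, ..., m - 1. Let the excess be length minus inversions; a letter with entry `e` changes it by
1 - `e`. Deleting the last letter thus gives `numPerms` and `ballot` the same recurrence, in
positive excess. Since excess rises by at most one per letter, cutting where it last equals `i`
leaves a ballot tail (`eq_sum_mul_ballot`). Tail of excess 1 gives the theorem; for `ballot` itself
it gives the Catalan recurrence. -/

section Recurrence

/-- `ballot n d` counts the sequences of `n` natural numbers each of whose nonempty prefixes has
sum less than its length and whose total sum is `n - d`. -/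
def ballot : ℕ → ℕ → ℕ
  | 0, d => if d = 0 then 1 else 0
  | _ + 1, 0 => 0
  | n + 1, d + 1 => ∑ e ∈ range (n + 1), ballot n (d + e)

lemma ballot_zero_zero : ballot 0 0 = 1 := by simp [ballot]

lemma ballot_zero_succ (d : ℕ) : ballot 0 (d + 1) = 0 := by simp [ballot]

lemma ballot_succ_zero (n : ℕ) : ballot (n + 1) 0 = 0 := by simp [ballot]

lemma ballot_succ_succ (n d : ℕ) :
    ballot (n + 1) (d + 1) = ∑ e ∈ range (n + 1), ballot n (d + e) := by simp [ballot]

lemma ballot_eq_zero_of_lt {n d : ℕ} (h : n < d) : ballot n d = 0 := by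
  induction n generalizing d with
  | zero => obtain ⟨d, rfl⟩ := Nat.exists_eq_succ_of_ne_zero h.ne'; exact ballot_zero_succ d
  | succ n ih =>
    obtain ⟨d, rfl⟩ := Nat.exists_eq_succ_of_ne_zero (Nat.ne_zero_of_lt h)
    rw [Nat.succ_eq_add_one, ballot_succ_succ]
    exact sum_eq_zero fun e _ => ih (by omega)

/-- Excess never exceeds length, so the extra terms vanish. This gives tails of different lengths a
common range of summation. -/
lemma ballot_succ_succ_of_le {n N : ℕ} (d : ℕ) (h : n ≤ N) :
    ballot (n + 1) (d + 1) = ∑ e ∈ range (N + 1), ballot n (d + e) := by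
  rw [ballot_succ_succ]
  refine sum_subset (range_mono (by omega)) fun e _ he => ballot_eq_zero_of_lt ?_
  rw [mem_range] at he
  omega

lemma sum_mul_ballot_zero (g : ℕ → ℕ) (n : ℕ) :
    ∑ k ∈ range (n + 1), g k * ballot (n - k) 0 = g n := by
  rw [sum_range_succ, Nat.sub_self, ballot_zero_zero, mul_one, Nat.add_eq_right]
  refine sum_eq_zero fun k hk => ?_
  rw [mem_range] at hk
  obtain ⟨m, hm⟩ := Nat.exists_eq_succ_of_ne_zero (n := n - k) (by omega)
  rw [hm, ballot_succ_zero, mul_zero]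

/-- Cutting a sequence at the last time its excess (length minus sum) equals `i`. -/
theorem eq_sum_mul_ballot {f : ℕ → ℕ → ℕ} (f_zero : ∀ d, f 0 (d + 1) = 0)
    (f_succ : ∀ n d, f (n + 1) (d + 1) = ∑ e ∈ range (n + 1), f n (d + e)) (n i d : ℕ) :
    f n (i + d) = ∑ k ∈ range (n + 1), f k i * ballot (n - k) d := by
  induction n generalizing d with
  | zero =>
    cases d with
    | zero => simp [ballot_zero_zero]
    | succ d => simp [ballot_zero_succ, ← add_assoc, f_zero]
  | succ n ih =>
    cases d with
    | zero => rw [sum_mul_ballot_zero (fun k => f k i), add_zero]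
    | succ d =>
      rw [← add_assoc, f_succ, sum_range_succ _ (n + 1), Nat.sub_self, ballot_zero_succ, mul_zero, add_zero]
      simp_rw [add_assoc i d, ih]
      rw [sum_comm]
      refine sum_congr rfl fun k hk => ?_
      rw [mem_range] at hk
      rw [← mul_sum, show n + 1 - k = (n - k) + 1 by omega,
        ballot_succ_succ_of_le d (Nat.sub_le n k)]

/-- The two recurrences differ by a shift of `e` and the term `ballot n 0`, which is zero for
positive `n`. -/
lemma ballot_succ_one (n : ℕ) (hn : n ≠ 0) : ballot (n + 1) 1 = ballot (n + 1) 2 := by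
  obtain ⟨m, rfl⟩ := Nat.exists_eq_succ_of_ne_zero hn
  rw [Nat.succ_eq_add_one, ballot_succ_succ_of_le 0 (Nat.le_succ (m + 1)),
    ballot_succ_succ_of_le 1 le_rfl, sum_range_succ', add_zero, ballot_succ_zero, add_zero]
  exact sum_congr rfl fun e _ => by rw [zero_add, add_comm 1]

theorem ballot_one_eq_catalan (n : ℕ) : ballot (n + 1) 1 = catalan n := by
  induction n using Nat.strong_induction_on with
  | _ n ih =>
    cases n with
    | zero => simp [ballot]
    | succ n =>
      -- Excess 2 = 1 + 1 can be cut into two pieces of excess 1.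
      rw [ballot_succ_one _ n.succ_ne_zero,
        eq_sum_mul_ballot ballot_zero_succ ballot_succ_succ (n + 1 + 1) 1 1, sum_range_succ,
        Nat.sub_self, ballot_zero_succ, mul_zero, add_zero, sum_range_succ', ballot_zero_succ,
        zero_mul, add_zero, catalan_succ', Nat.sum_antidiagonal_eq_sum_range_succ
          (fun i j => catalan i * catalan j)]
      refine sum_congr rfl fun k hk => ?_
      rw [mem_range] at hk
      rw [show n + 1 + 1 - (k + 1) = (n - k) + 1 by omega, ih k (by omega), ih (n - k) (by omega)]

end Recurrence

section AppendLetter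

variable {n : ℕ}

/-- The permutation of `Fin (n + 1)` whose last letter has `e` larger letters to its left and whose
other letters are in the same relative order as those of `σ`. -/
def appendLetter (e : Fin (n + 1)) (σ : Equiv.Perm (Fin n)) : Equiv.Perm (Fin (n + 1)) :=
  ((finSuccEquiv' (Fin.last n)).trans (Equiv.optionCongr σ)).trans (finSuccEquiv' e.rev).symm

@[simp]
lemma appendLetter_last (e : Fin (n + 1)) (σ : Equiv.Perm (Fin n)) :
    appendLetter e σ (Fin.last n) = e.rev := by
  simp [appendLetter]

@[simp]
lemma appendLetter_castSucc (e : Fin (n + 1)) (σ : Equiv.Perm (Fin n)) (j : Fin n) :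
    appendLetter e σ j.castSucc = e.rev.succAbove (σ j) := by
  rw [← Fin.succAbove_last_apply]
  simp only [appendLetter, Equiv.trans_apply, finSuccEquiv'_succAbove, Equiv.optionCongr_apply,
    Option.map_some, finSuccEquiv'_symm_some]

lemma appendLetter_bijective :
    Function.Bijective fun p : Fin (n + 1) × Equiv.Perm (Fin n) => appendLetter p.1 p.2 := by
  rw [Fintype.bijective_iff_injective_and_card]
  constructor
  · rintro ⟨e, σ⟩ ⟨e', σ'⟩ h
    have h' : ∀ j, appendLetter e σ j = appendLetter e' σ' j := fun j => by
      simpa using congrArg (fun π : Equiv.Perm (Fin (n + 1)) => π j) h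
    obtain rfl : e = e' := by simpa using h' (Fin.last n)
    obtain rfl : σ = σ' := Equiv.ext fun j => by simpa using h' j.castSucc
    rfl
  · simp [Fintype.card_perm, Nat.factorial_succ]

lemma invTable_eq_sum (π : Equiv.Perm (Fin n)) (j : Fin n) :
    invTable π j = ∑ i, if i < j ∧ π j < π i then 1 else 0 := by
  rw [invTable, card_filter]

lemma invTable_appendLetter_castSucc (e : Fin (n + 1)) (σ : Equiv.Perm (Fin n)) (j : Fin n) :
    invTable (appendLetter e σ) j.castSucc = invTable σ j := by
  simp [invTable_eq_sum, Fin.sum_univ_castSucc, Fin.succAbove_lt_succAbove_iff,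
    (Fin.castSucc_lt_last j).not_gt, -sum_boole]

lemma invTable_appendLetter_last (e : Fin (n + 1)) (σ : Equiv.Perm (Fin n)) :
    invTable (appendLetter e σ) (Fin.last n) = e := by
  have h : (univ.filter fun i : Fin (n + 1) =>
      i < Fin.last n ∧ appendLetter e σ (Fin.last n) < appendLetter e σ i) =
      (Ioi e.rev).map (appendLetter e σ).symm.toEmbedding := by
    ext i
    simp only [mem_filter, mem_univ, true_and, appendLetter_last, mem_map_equiv, Equiv.symm_symm,
      mem_Ioi, and_iff_right_iff_imp]
    intro hi
    refine Fin.lt_last_iff_ne_last.2 ?_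
    rintro rfl
    simp at hi
  rw [invTable, h, card_map, Fin.card_Ioi, Fin.val_rev]
  omega

lemma inv_appendLetter (e : Fin (n + 1)) (σ : Equiv.Perm (Fin n)) :
    inv (appendLetter e σ) = inv σ + e := by
  simp [inv, Fin.sum_univ_castSucc, invTable_appendLetter_castSucc, invTable_appendLetter_last]

lemma prefixInv_appendLetter (e : Fin (n + 1)) (σ : Equiv.Perm (Fin n)) {k : ℕ} (hk : k ≤ n) :
    prefixInv (appendLetter e σ) k = prefixInv σ k := by
  simp [prefixInv, sum_filter, Fin.sum_univ_castSucc, invTable_appendLetter_castSucc, hk.not_gt]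

lemma prefixInv_self (π : Equiv.Perm (Fin n)) : prefixInv π n = inv π := by
  simp [prefixInv, inv]

lemma card_filter_perm_succ (P : Equiv.Perm (Fin (n + 1)) → Prop) [DecidablePred P] :
    #{π | P π} = ∑ e : Fin (n + 1), #{σ | P (appendLetter e σ)} := by
  simp_rw [card_filter]
  rw [← Fintype.sum_prod_type', ← appendLetter_bijective.sum_comp]

end AppendLetter

section Counting

/-- The number of permutations of `[n]` with exactly `n - d` inversions. -/
def numPerms (n d : ℕ) : ℕ :=
  #{π : Equiv.Perm (Fin n) | inv π + d = n}

lemma card_permsInv (n d : ℕ) : #(permsInv n ((n : ℤ) - d)) = numPerms n d := by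
  rw [permsInv, numPerms]
  congr 1
  ext π
  simp only [mem_filter, mem_univ, true_and]
  omega

lemma numPerms_zero_succ (d : ℕ) : numPerms 0 (d + 1) = 0 := by
  simp [numPerms]

lemma numPerms_succ_succ (n d : ℕ) :
    numPerms (n + 1) (d + 1) = ∑ e ∈ range (n + 1), numPerms n (d + e) := by
  rw [numPerms, card_filter_perm_succ, sum_range]
  refine sum_congr rfl fun e _ => ?_
  rw [numPerms]
  congr 1
  ext σ
  simp only [mem_filter, mem_univ, true_and, inv_appendLetter]
  omega

lemma card_filter_prefixInv_lt (n d : ℕ) :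
    #{π : Equiv.Perm (Fin n) | inv π + d = n ∧ ∀ k ≤ n, 1 ≤ k → prefixInv π k < k} =
      ballot n d := by
  induction n generalizing d with
  | zero =>
    cases d with
    | zero =>
      rw [ballot_zero_zero, card_eq_one]
      refine ⟨1, ?_⟩
      ext π
      simp [Subsingleton.elim π 1, inv]
    | succ d => simp [ballot_zero_succ]
  | succ n ih =>
    cases d with
    -- Excess 0 violates the condition on the full prefix.
    | zero =>
      rw [ballot_succ_zero, card_eq_zero, filter_eq_empty_iff]
      rintro π - ⟨h, h'⟩
      have := h' (n + 1) le_rfl (by omega)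
      rw [prefixInv_self] at this
      omega
    | succ d =>
      rw [card_filter_perm_succ, ballot_succ_succ, sum_range]
      refine sum_congr rfl fun e _ => ?_
      rw [← ih]
      congr 1
      ext σ
      simp only [mem_filter, mem_univ, true_and, inv_appendLetter]
      refine ⟨fun ⟨h, h'⟩ => ⟨by omega, fun k hk hk' => ?_⟩,
        fun ⟨h, h'⟩ => ⟨by omega, fun k hk hk' => ?_⟩⟩
      · rw [← prefixInv_appendLetter e σ hk]
        exact h' k (by omega) hk'
      · obtain hk | rfl := Nat.le_succ_iff.1 hk
        · rw [prefixInv_appendLetter e σ hk]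
          exact h' k hk hk'
        -- The only new condition, on the full prefix, holds because the excess `d + 1` is positive.
        · rw [Nat.succ_eq_add_one, prefixInv_self, inv_appendLetter]
          omega

lemma card_catPerms (n : ℕ) : #(catPerms n) = ballot n 1 := by
  rw [← card_filter_prefixInv_lt, catPerms, permsInv, filter_filter]
  congr 1
  ext π
  simp only [mem_filter, mem_univ, true_and]
  refine and_congr_left fun _ => ?_
  omega

lemma numPerms_succ_right (n i : ℕ) :
    numPerms n (i + 1) = ∑ k ∈ range (n + 1), numPerms k i * ballot (n - k) 1 :=
  eq_sum_mul_ballot numPerms_zero_succ numPerms_succ_succ n i 1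

lemma coeff_X_mul_catalanSeries (n : ℕ) :
    PowerSeries.coeff n (PowerSeries.X * PowerSeries.catalanSeries) = ballot n 1 := by
  cases n with
  | zero => simp [ballot_zero_succ 0]
  | succ n => simp [PowerSeries.coeff_succ_X_mul, ballot_one_eq_catalan]

theorem S_succ (i : ℕ) : S (i + 1) = PowerSeries.X * PowerSeries.catalanSeries * S i := by
  ext n
  rw [mul_comm, PowerSeries.coeff_mul, S, PowerSeries.coeff_mk, card_permsInv,
    numPerms_succ_right, Nat.sum_antidiagonal_eq_sum_range_succ_mk]
  refine sum_congr rfl fun k _ => ?_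
  rw [coeff_X_mul_catalanSeries, S, PowerSeries.coeff_mk, card_permsInv]

end Counting

end FewInversions

open FewInversions in
theorem mainTheorem2 :
    (∀ m : ℕ, 1 ≤ m → (FewInversions.catPerms m).card = catalan (m - 1)) ∧
    (∀ i n : ℕ, Nonempty
      (FewInversions.permsInv n ((n : ℤ) - (i : ℤ) - 1) ≃
        Σ k : Fin (n + 1),
          FewInversions.permsInv (k : ℕ) (((k : ℕ) : ℤ) - (i : ℤ)) ×
            FewInversions.catPerms (n - (k : ℕ)))) ∧
    (∀ i : ℕ, FewInversions.S (i + 1) =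
      PowerSeries.X * PowerSeries.catalanSeries * FewInversions.S i) ∧
    (∀ i : ℕ, FewInversions.S i =
      (PowerSeries.X * PowerSeries.catalanSeries) ^ i * FewInversions.S 0) := by
  refine ⟨fun m hm => ?_, fun i n => ?_, S_succ, fun i => ?_⟩
  · obtain ⟨m, rfl⟩ := Nat.exists_eq_add_of_le' hm
    rw [card_catPerms, ballot_one_eq_catalan, Nat.add_sub_cancel]
  -- The bijection comes from equality of cardinalities.
  · rw [← Fintype.card_eq, Fintype.card_coe,
      show (n : ℤ) - i - 1 = n - ((i + 1 : ℕ) : ℤ) by push_cast; ring, card_permsInv,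
      numPerms_succ_right, Finset.sum_range, Fintype.card_sigma]
    refine Finset.sum_congr rfl fun k _ => ?_
    rw [Fintype.card_prod, Fintype.card_coe, Fintype.card_coe, card_permsInv, card_catPerms]
  · induction i with
    | zero => rw [pow_zero, one_mul]
    | succ i ih => rw [S_succ, ih, pow_succ', mul_assoc (_ * _)]
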